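/- Let $\mathcal{C}$ be a noetherian integral domain, let $n$ be a positive integer, and write $x=(x_1,\dots,x_n)$. Let $\preceq$ be an arbitrary monomial order, that is, a total order on $\mathbb{N}^n$ (identified with the set of monomials $x^\alpha$) such that $\alpha\prec\alpha'$ implies $\alpha+\alpha''\prec\alpha'+\alpha''$ for all $\alpha''\in\mathbb{N}^n$; it is not assumed to be a well-ordering. For a field $\mathbf{K}$ and a non-zero $f\in\mathbf{K}[x]$, let $\exp_\preceq(f)\in\mathbb{N}^n$ be the $\preceq$-largest exponent of a monomial occurring in $f$. A $\preceq$-standard basis of an ideal $I\subset\mathbf{K}[x]$ is a finite set $G\subset I$ such that \[ \{\exp_\preceq(f) : f\in I\smallsetminus\{0\}\}=\bigcup_{g\in G,\ g\neq 0}\bigl(\exp_\preceq(g)+\mathbb{N}^n\bigr). \] A specialization of $\mathcal{C}$ is a ring homomorphism $\sigma:\mathcal{C}\to\mathbf{K}$ to a field $\mathbf{K}$; the homomorphism $\mathcal{C}[x]\to\mathbf{K}[x]$ that applies $\sigma$ to the coefficients is also denoted by $\sigma$. Let $J\subset\mathcal{C}[x]$ be a finitely generated ideal. Then there exists a finite set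 $\mathcal{G}\subset J$ such that for every field $\mathbf{K}$ and every specialization $\sigma:\mathcal{C}\to\mathbf{K}$ with $\sigma(J)\neq\{0\}$, the set $\sigma(\mathcal{G})$ is a $\preceq$-standard basis of the ideal $\mathbf{K}[x]\,\sigma(J)$ generated by $\sigma(J)$. -/

import Mathlib

universe u v

namespace ParamSB

/-- A monomial order on the monomials `x ^ α`, `α ∈ ℕⁿ`: a total order on the exponents that is
compatible with addition. It is not assumed to be a well-ordering. -/
structure MonOrder (n : ℕ) where
  le : (Fin n →₀ ℕ) → (Fin n →₀ ℕ) → Prop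
  le_refl : ∀ a, le a a
  le_trans : ∀ a b c, le a b → le b c → le a c
  le_antisymm : ∀ a b, le a b → le b a → a = b
  le_total : ∀ a b, le a b ∨ le b a
  add_compat : ∀ a b c, (le a b ∧ a ≠ b) → (le (a + c) (b + c) ∧ a + c ≠ b + c)

variable {n : ℕ} {R : Type*} [CommRing R]

theorem MonOrder.exists_max (o : MonOrder n) (s : Finset (Fin n →₀ ℕ)) (hs : s.Nonempty) :
    ∃ α ∈ s, ∀ β ∈ s, o.le β α := by
  induction hs using Finset.Nonempty.cons_induction with
  | singleton a => exact ⟨a, by simp, by simpa using o.le_refl a⟩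
  | cons a s ha hs ih =>
    obtain ⟨α, hα, hmax⟩ := ih
    rcases o.le_total a α with h | h
    · refine ⟨α, by simp [hα], fun β hβ => ?_⟩
      rcases Finset.mem_cons.1 hβ with rfl | hβ
      · exact h
      · exact hmax β hβ
    · refine ⟨a, by simp, fun β hβ => ?_⟩
      rcases Finset.mem_cons.1 hβ with rfl | hβ
      · exact o.le_refl _
      · exact o.le_trans _ _ _ (hmax β hβ) h

open Classical in
/-- The leading exponent of a non-zero polynomial: the largest exponent of its support.
The value at `f = 0` is irrelevant; it is never used below. -/
noncomputable def leadExp (o : MonOrder n) (f : MvPolynomial (Fin n) R) : Fin n →₀ ℕ :=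
  if hf : f = 0 then 0
  else Classical.choose (o.exists_max f.support (MvPolynomial.support_nonempty.2 hf))

theorem leadExp_spec (o : MonOrder n) (f : MvPolynomial (Fin n) R) (hf : f ≠ 0) :
    leadExp o f ∈ f.support ∧ ∀ β ∈ f.support, o.le β (leadExp o f) := by
  rw [leadExp, dif_neg hf]
  exact Classical.choose_spec (o.exists_max f.support (MvPolynomial.support_nonempty.2 hf))

/-- The set `Exp(I)` of the leading exponents of the non-zero elements of an ideal `I`. -/
def expSet (o : MonOrder n) (I : Ideal (MvPolynomial (Fin n) R)) : Set (Fin n →₀ ℕ) :=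
  {α | ∃ f ∈ I, f ≠ 0 ∧ leadExp o f = α}

/-- `G` is a standard basis of the ideal `I`: a finite subset of `I` such that `Exp(I)` is the
union of the sets `exp(g) + ℕⁿ`, where `g` runs over the elements of `G` that have a leading
exponent, that is, over the non-zero ones. -/
structure IsStandardBasis (o : MonOrder n) (I : Ideal (MvPolynomial (Fin n) R))
    (G : Set (MvPolynomial (Fin n) R)) : Prop where
  finite : G.Finite
  subset : G ⊆ (I : Set (MvPolynomial (Fin n) R))
  expSet_eq : expSet o I = ⋃ g ∈ {g ∈ G | g ≠ 0}, {α | ∃ γ : Fin n →₀ ℕ, α = leadExp o g + γ}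

end ParamSB

/-! Since the order need not be a well-ordering, division may fail to terminate; bounding the total
degree leaves finitely many exponents and restores termination. For this, each f in J is recorded by
its leading exponent α together with an e such that deg f ≤ |α| + e. By Dickson's lemma in ℕⁿ × ℕ,
finitely many g ∈ J lie below all these pairs, so any leading exponent found in J in degree ≤ d is
that of a monomial multiple of some g, still of degree ≤ d. Over a domain, let σ keep the leading
coefficients of these g non-zero. Reduction in degree ≤ d (`map_mem_span_of_degLE`) shows that the
images of these multiples span σ(J_{≤d}) over K. Their leading exponents are distinct, so no others
occur in the span (`exists_isLead_of_mem_span`). This gives the generic case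
`exists_covers_generic`; the other specializations are reached by noetherian induction on an ideal
contained in the kernel of σ (`exists_covers`). -/

namespace ParamSB

open MvPolynomial hiding R

variable {n : ℕ} {R : Type*} [CommRing R]

/-! ### Leading exponents -/

/-- `α` is the leading exponent of the (necessarily non-zero) polynomial `f`. -/
def IsLead (o : MonOrder n) (f : MvPolynomial (Fin n) R) (α : Fin n →₀ ℕ) : Prop :=
  coeff α f ≠ 0 ∧ ∀ β, coeff β f ≠ 0 → o.le β α

theorem isLead_leadExp (o : MonOrder n) {f : MvPolynomial (Fin n) R} (hf : f ≠ 0) :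
    IsLead o f (leadExp o f) := by
  obtain ⟨h1, h2⟩ := leadExp_spec o f hf
  exact ⟨mem_support_iff.1 h1, fun β hβ => h2 β (mem_support_iff.2 hβ)⟩

theorem IsLead.ne_zero {o : MonOrder n} {f : MvPolynomial (Fin n) R} {α : Fin n →₀ ℕ}
    (h : IsLead o f α) : f ≠ 0 := by
  rintro rfl
  exact h.1 (coeff_zero _)

theorem IsLead.eq_leadExp {o : MonOrder n} {f : MvPolynomial (Fin n) R} {α : Fin n →₀ ℕ}
    (h : IsLead o f α) : leadExp o f = α :=
  have h' := isLead_leadExp o h.ne_zero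
  o.le_antisymm _ _ (h.2 _ h'.1) (h'.2 _ h.1)

theorem MonOrder.add_le_add (o : MonOrder n) {a b : Fin n →₀ ℕ} (c : Fin n →₀ ℕ)
    (h : o.le a b) : o.le (c + a) (c + b) := by
  by_cases hab : a = b
  · subst hab
    exact o.le_refl _
  · rw [add_comm c a, add_comm c b]
    exact (o.add_compat a b c ⟨h, hab⟩).1

theorem exists_of_coeff_monomial_mul_ne_zero {γ β : Fin n →₀ ℕ} {f : MvPolynomial (Fin n) R}
    (h : coeff β (monomial γ 1 * f) ≠ 0) : ∃ δ, β = γ + δ ∧ coeff δ f ≠ 0 := by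
  rw [coeff_monomial_mul'] at h
  split_ifs at h with hle
  · exact ⟨β - γ, (add_tsub_cancel_of_le hle).symm, by simpa using h⟩
  · exact absurd rfl h

theorem IsLead.monomial_mul {o : MonOrder n} {f : MvPolynomial (Fin n) R} {α : Fin n →₀ ℕ}
    (h : IsLead o f α) (γ : Fin n →₀ ℕ) : IsLead o (monomial γ 1 * f) (γ + α) := by
  refine ⟨by simpa [coeff_monomial_mul] using h.1, fun β hβ => ?_⟩
  obtain ⟨δ, rfl, hδ⟩ := exists_of_coeff_monomial_mul_ne_zero hβ
  exact o.add_le_add γ (h.2 δ hδ)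

theorem IsLead.map {S : Type*} [CommRing S] {o : MonOrder n} {f : MvPolynomial (Fin n) R}
    {α : Fin n →₀ ℕ} (h : IsLead o f α) (σ : R →+* S) (hσ : σ (coeff α f) ≠ 0) :
    IsLead o (MvPolynomial.map σ f) α := by
  refine ⟨by simpa [coeff_map] using hσ, fun β hβ => h.2 β fun h0 => hβ ?_⟩
  rw [coeff_map, h0, map_zero]

/-- Lets finite sets of exponents count as well-founded for the order, which drives the induction in
bounded degree. -/
instance (o : MonOrder n) : IsStrictOrder (Fin n →₀ ℕ) (fun a b => o.le a b ∧ a ≠ b) where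
  irrefl _ h := h.2 rfl
  trans a b c h1 h2 := ⟨o.le_trans _ _ _ h1.1 h2.1, fun h => by
    subst h
    exact h1.2 (o.le_antisymm _ _ h1.1 h2.1)⟩

/-- In a partial well-quasi-order every set is dominated from below by a finite subset. -/
theorem exists_finset_le {X : Type*} [PartialOrder X] [WellQuasiOrderedLE X] (s : Set X) :
    ∃ t : Finset X, (t : Set X) ⊆ s ∧ ∀ a ∈ s, ∃ b ∈ t, b ≤ a := by
  have hfin : {a | Minimal (· ∈ s) a}.Finite :=
    WellQuasiOrderedLE.finite_of_isAntichain (setOfPred_minimal_antichain (· ∈ s))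
  refine ⟨hfin.toFinset, fun a ha => ?_, fun a ha => ?_⟩
  · exact (by simpa using ha : Minimal (· ∈ s) a).1
  · obtain ⟨b, hb, hmin⟩ := exists_minimal_le_of_wellFoundedLT (· ∈ s) a ha
    exact ⟨b, by simpa using hmin, hb⟩

/-- A non-zero linear combination of polynomials with pairwise distinct leading exponents has the
leading exponent of one of them. -/
theorem exists_isLead_of_mem_span {K : Type*} [Field K] (o : MonOrder n) {s : Set (Fin n →₀ ℕ)}
    {b : (Fin n →₀ ℕ) → MvPolynomial (Fin n) K} (hb : ∀ α ∈ s, IsLead o (b α) α)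
    {h : MvPolynomial (Fin n) K} (hh : h ∈ Submodule.span K (b '' s)) (h0 : h ≠ 0) :
    ∃ α ∈ s, IsLead o h α := by
  obtain ⟨l, hl, rfl⟩ := (Finsupp.mem_span_image_iff_linearCombination K).1 hh
  have hl0 : l.support.Nonempty := by
    rw [Finsupp.support_nonempty_iff]
    rintro rfl
    exact h0 (map_zero _)
  obtain ⟨α, hα, hmax⟩ := o.exists_max l.support hl0
  have hs : ∀ β ∈ l.support, β ∈ s := fun β hβ => (Finsupp.mem_supported K l).1 hl hβ
  have hco : ∀ β, coeff β (Finsupp.linearCombination K b l) =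
      ∑ δ ∈ l.support, l δ * coeff β (b δ) := fun β => by
    simp [Finsupp.linearCombination_apply, Finsupp.sum, coeff_sum]
  refine ⟨α, hs α hα, ?_, fun β hβ => ?_⟩
  -- Only `b α` contributes at the largest index α: if `x ^ α` occurs in `b δ`, then α ≤ δ ≤ α.
  · rw [hco, Finset.sum_eq_single_of_mem α hα]
    · exact mul_ne_zero (Finsupp.mem_support_iff.1 hα) (hb α (hs α hα)).1
    · intro δ hδ hne
      by_contra hc
      exact hne (o.le_antisymm _ _ (hmax δ hδ) ((hb δ (hs δ hδ)).2 α (right_ne_zero_of_mul hc)))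
  · rw [hco] at hβ
    obtain ⟨δ, hδ, hne⟩ := Finset.exists_ne_zero_of_sum_ne_zero hβ
    exact o.le_trans _ _ _ ((hb δ (hs δ hδ)).2 β (right_ne_zero_of_mul hne)) (hmax δ hδ)

/-! ### Reduction in bounded degree -/

/-- The exponents of `f` have total degree at most `d`. -/
def DegLE (f : MvPolynomial (Fin n) R) (d : ℕ) : Prop :=
  ∀ β, coeff β f ≠ 0 → β.degree ≤ d

theorem exists_degLE (f : MvPolynomial (Fin n) R) : ∃ d, DegLE f d :=
  ⟨f.support.sup Finsupp.degree, fun _ hβ =>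
    Finset.le_sup (f := Finsupp.degree) (mem_support_iff.2 hβ)⟩

theorem DegLE.monomial_mul {f : MvPolynomial (Fin n) R} {d : ℕ} (h : DegLE f d)
    (γ : Fin n →₀ ℕ) : DegLE (monomial γ 1 * f) (γ.degree + d) := by
  intro β hβ
  obtain ⟨δ, rfl, hδ⟩ := exists_of_coeff_monomial_mul_ne_zero hβ
  rw [map_add]
  exact Nat.add_le_add_left (h δ hδ) _

/-- Reduction in bounded degree: if an ideal contains, for every leading exponent of its elements
of degree at most `d`, an element `b α` of degree at most `d` with that leading exponent, and `σ`
does not kill the leading coefficients of the `b α`, then the `σ (b α)` span the images of all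
elements of degree at most `d`. -/
theorem map_mem_span_of_degLE {K : Type*} [Field K] (o : MonOrder n)
    {J : Ideal (MvPolynomial (Fin n) R)} {d : ℕ} (σ : R →+* K) {s : Set (Fin n →₀ ℕ)}
    {b : (Fin n →₀ ℕ) → MvPolynomial (Fin n) R}
    (hs : ∀ f ∈ J, DegLE f d → ∀ α, IsLead o f α → α ∈ s)
    (hbJ : ∀ α ∈ s, b α ∈ J) (hbd : ∀ α ∈ s, DegLE (b α) d) (hb : ∀ α ∈ s, IsLead o (b α) α)
    (hσ : ∀ α ∈ s, σ (coeff α (b α)) ≠ 0) {f : MvPolynomial (Fin n) R} (hf : f ∈ J)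
    (hfd : DegLE f d) :
    MvPolynomial.map σ f ∈ Submodule.span K ((fun α => MvPolynomial.map σ (b α)) '' s) := by
  set W := Submodule.span K ((fun α => MvPolynomial.map σ (b α)) '' s)
  have hwf : {α : Fin n →₀ ℕ | α.degree ≤ d}.WellFoundedOn (fun a b => o.le a b ∧ a ≠ b) :=
    (Finsupp.finite_of_degree_le d).wellFoundedOn
  have key : ∀ α : Fin n →₀ ℕ, α.degree ≤ d → ∀ f ∈ J, DegLE f d → IsLead o f α →
      MvPolynomial.map σ f ∈ W := by
    intro α hα
    refine hwf.induction (P := fun α => ∀ f ∈ J, DegLE f d → IsLead o f α →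
      MvPolynomial.map σ f ∈ W) hα ?_
    intro α hα ih f hf hfd hlead
    have hαs := hs f hf hfd α hlead
    -- Cross-multiplication cancels the leading terms without dividing in the coefficient ring; the
    -- factor put on f becomes invertible in K.
    set g := C (coeff α (b α)) * f - C (coeff α f) * b α with hg
    have hgJ : g ∈ J := J.sub_mem (J.mul_mem_left _ hf) (J.mul_mem_left _ (hbJ α hαs))
    have hgc : ∀ β, coeff β g ≠ 0 → coeff β f ≠ 0 ∨ coeff β (b α) ≠ 0 := by
      intro β hβ
      by_contra! hc
      simp [hg, hc.1, hc.2] at hβ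
    have hgd : DegLE g d := fun β hβ => (hgc β hβ).elim (hfd β) (hbd α hαs β)
    have hgα : coeff α g = 0 := by
      simp [hg, coeff_C_mul, mul_comm (coeff α f)]
    have hgW : MvPolynomial.map σ g ∈ W := by
      by_cases hg0 : g = 0
      · simp [hg0]
      · have hl := isLead_leadExp o hg0
        refine ih (leadExp o g) (hgd _ hl.1) ⟨?_, ?_⟩ g hgJ hgd hl
        · exact (hgc _ hl.1).elim (hlead.2 _) ((hb α hαs).2 _)
        · intro h
          exact hl.1 (h ▸ hgα)
    have hbW : MvPolynomial.map σ (b α) ∈ W := Submodule.subset_span ⟨α, hαs, rfl⟩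
    have heq : σ (coeff α (b α)) • MvPolynomial.map σ f =
        MvPolynomial.map σ g + σ (coeff α f) • MvPolynomial.map σ (b α) := by
      simp [hg, smul_eq_C_mul]
    refine (Submodule.smul_mem_iff W (hσ α hαs)).1 ?_
    rw [heq]
    exact W.add_mem hgW (W.smul_mem _ hbW)
  by_cases hf0 : f = 0
  · simp [hf0]
  · have hl := isLead_leadExp o hf0
    exact key _ (hfd _ hl.1) f hf hfd hl

/-! ### Extension of ideals along a specialization -/

/-- The extension of an ideal along a coefficient map to a field is the linear span of the
image. -/
theorem mem_span_of_mem_map {K : Type*} [Field K] {J : Ideal (MvPolynomial (Fin n) R)}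
    (σ : R →+* K) {h : MvPolynomial (Fin n) K} (hh : h ∈ J.map (MvPolynomial.map σ)) :
    h ∈ Submodule.span K (MvPolynomial.map σ '' (J : Set (MvPolynomial (Fin n) R))) := by
  refine Submodule.span_induction (fun x hx => Submodule.subset_span hx) (Submodule.zero_mem _)
    (fun x y _ _ => Submodule.add_mem _) (fun r x _ hx => ?_) hh
  induction r using MvPolynomial.induction_on' with
  | add p q hp hq =>
    rw [add_smul]
    exact Submodule.add_mem _ hp hq
  | monomial γ k =>
    refine Submodule.span_induction ?_ (by simp) ?_ ?_ hx
    · rintro _ ⟨f, hf, rfl⟩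
      -- The scalar k moves out into the K-span, while the power product is already defined over the
      -- base and is absorbed by J.
      have : monomial γ k • MvPolynomial.map σ f =
          k • MvPolynomial.map σ (monomial γ 1 * f) := by
        rw [map_mul, map_monomial, map_one, smul_eq_mul, ← smul_mul_assoc, smul_monomial,
          smul_eq_mul, mul_one]
      rw [this]
      exact Submodule.smul_mem _ _ (Submodule.subset_span ⟨_, J.mul_mem_left _ hf, rfl⟩)
    · intro x y _ _ hx hy
      rw [smul_add]
      exact Submodule.add_mem _ hx hy
    · intro a x _ hx
      rw [smul_comm]
      exact Submodule.smul_mem _ _ hx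

/-- An element of the linear span of `σ(J)` lies in the span of the images of the elements of
bounded degree. -/
theorem exists_mem_span_degLE {K : Type*} [Field K] {J : Ideal (MvPolynomial (Fin n) R)}
    (σ : R →+* K) {h : MvPolynomial (Fin n) K} (hh : h ∈ J.map (MvPolynomial.map σ)) :
    ∃ d, h ∈ Submodule.span K (MvPolynomial.map σ '' {f | f ∈ J ∧ DegLE f d}) := by
  have mono : ∀ {d e : ℕ}, d ≤ e →
      Submodule.span K (MvPolynomial.map σ '' {f | f ∈ J ∧ DegLE f d}) ≤
        Submodule.span K (MvPolynomial.map σ '' {f | f ∈ J ∧ DegLE f e}) := fun hde =>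
    Submodule.span_mono (Set.image_mono fun f hf =>
      ⟨hf.1, fun β hβ => (hf.2 β hβ).trans hde⟩)
  refine Submodule.span_induction ?_ ⟨0, Submodule.zero_mem _⟩ ?_ ?_ (mem_span_of_mem_map σ hh)
  · rintro _ ⟨f, hf, rfl⟩
    obtain ⟨d, hd⟩ := exists_degLE f
    exact ⟨d, Submodule.subset_span ⟨f, ⟨hf, hd⟩, rfl⟩⟩
  · rintro x y _ _ ⟨d, hd⟩ ⟨e, he⟩
    exact ⟨max d e, Submodule.add_mem _ (mono (le_max_left _ _) hd) (mono (le_max_right _ _) he)⟩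
  · rintro a x _ ⟨d, hd⟩
    exact ⟨d, Submodule.smul_mem _ _ hd⟩

/-- Every leading exponent of the extension of `J` along `σ` is a multiple of the leading exponent
of some specialized element of `G`. -/
def Covers {K : Type*} [Field K] (o : MonOrder n) (J : Ideal (MvPolynomial (Fin n) R))
    (G : Set (MvPolynomial (Fin n) R)) (σ : R →+* K) : Prop :=
  ∀ h ∈ J.map (MvPolynomial.map σ), h ≠ 0 → ∃ g ∈ G, ∃ γ α,
    IsLead o (MvPolynomial.map σ g) α ∧ IsLead o h (γ + α)

theorem Covers.mono {K : Type*} [Field K] {o : MonOrder n} {J : Ideal (MvPolynomial (Fin n) R)}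
    {G G' : Set (MvPolynomial (Fin n) R)} {σ : R →+* K} (h : Covers o J G σ) (hG : G ⊆ G') :
    Covers o J G' σ := fun f hf hf0 =>
  let ⟨g, hg, hγ⟩ := h f hf hf0
  ⟨g, hG hg, hγ⟩

theorem Covers.isStandardBasis {K : Type*} [Field K] {o : MonOrder n}
    {J : Ideal (MvPolynomial (Fin n) R)} {G : Finset (MvPolynomial (Fin n) R)} {σ : R →+* K}
    (h : Covers o J (G : Set _) σ) (hG : (G : Set (MvPolynomial (Fin n) R)) ⊆ J) :
    IsStandardBasis o (J.map (MvPolynomial.map σ)) (MvPolynomial.map σ '' (G : Set _)) := by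
  have hsub : MvPolynomial.map σ '' (G : Set (MvPolynomial (Fin n) R)) ⊆
      (J.map (MvPolynomial.map σ) : Ideal (MvPolynomial (Fin n) K)) := by
    rintro _ ⟨g, hg, rfl⟩
    exact Ideal.mem_map_of_mem _ (hG hg)
  refine ⟨G.finite_toSet.image _, hsub, Set.ext fun α => ⟨?_, fun hα => ?_⟩⟩
  · rintro ⟨f, hf, hf0, rfl⟩
    obtain ⟨g, hg, γ, δ, hgδ, hfl⟩ := h f hf hf0
    refine Set.mem_biUnion (x := MvPolynomial.map σ g) ⟨⟨g, hg, rfl⟩, hgδ.ne_zero⟩ ⟨γ, ?_⟩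
    rw [hfl.eq_leadExp, hgδ.eq_leadExp, add_comm]
  · obtain ⟨g, ⟨hg, hg0⟩, γ, rfl⟩ := Set.mem_iUnion₂.1 hα
    have hl := (isLead_leadExp o hg0).monomial_mul γ
    exact ⟨monomial γ 1 * g, Ideal.mul_mem_left _ _ (hsub hg), hl.ne_zero,
      by rw [hl.eq_leadExp, add_comm]⟩

/-! ### Generic specializations -/

/-- Over a domain, a finite subset of `J` covers for all specializations that do not kill a
suitable non-zero constant. -/
theorem exists_covers_generic {A : Type u} [CommRing A] [IsDomain A] (o : MonOrder n)
    (J : Ideal (MvPolynomial (Fin n) A)) :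
    ∃ c : A, c ≠ 0 ∧ ∃ G : Finset (MvPolynomial (Fin n) A),
      (G : Set (MvPolynomial (Fin n) A)) ⊆ J ∧
      ∀ (K : Type v) [Field K] (σ : A →+* K), σ c ≠ 0 → Covers o J (G : Set _) σ := by
  classical
  -- The second component bounds the excess of the total degree over the degree of the leading
  -- exponent; multiplying by a monomial does not change this excess.
  obtain ⟨t, hts, ht⟩ := exists_finset_le {p : (Fin n →₀ ℕ) × ℕ |
    ∃ f ∈ J, IsLead o f p.1 ∧ DegLE f (p.1.degree + p.2)}
  have hts' : ∀ p ∈ t, ∃ f ∈ J, IsLead o f p.1 ∧ DegLE f (p.1.degree + p.2) :=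
    fun p hp => hts hp
  choose! g hgJ hgl hgd using hts'
  refine ⟨∏ p ∈ t, coeff p.1 (g p), Finset.prod_ne_zero_iff.2 fun p hp => (hgl p hp).1,
    t.image g, ?_, fun K _ σ hσ h hh h0 => ?_⟩
  · intro f hf
    obtain ⟨p, hp, rfl⟩ := Finset.mem_image.1 (Finset.mem_coe.1 hf)
    exact hgJ p hp
  have hσp : ∀ p ∈ t, σ (coeff p.1 (g p)) ≠ 0 := by
    rw [map_prod] at hσ
    exact Finset.prod_ne_zero_iff.1 hσ
  obtain ⟨d, hd⟩ := exists_mem_span_degLE σ hh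
  have hex : ∀ α ∈ {α | ∃ f ∈ J, DegLE f d ∧ IsLead o f α}, ∃ p ∈ t, ∃ γ,
      γ + p.1 = α ∧ γ.degree + (p.1.degree + p.2) ≤ d := by
    rintro α ⟨f, hf, hfd, hfl⟩
    have hαd := hfd α hfl.1
    -- The excess allowed within degree d is d - |α|; as `p.2` is at most this, the multiple with
    -- leading exponent α stays in degree ≤ d.
    obtain ⟨p, hp, hle⟩ := ht (α, d - α.degree) ⟨f, hf, hfl, by
      simpa [Nat.add_sub_cancel' hαd] using hfd⟩
    have hadd : α - p.1 + p.1 = α := tsub_add_cancel_of_le hle.1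
    refine ⟨p, hp, α - p.1, hadd, ?_⟩
    have hdeg : (α - p.1).degree + p.1.degree = α.degree := by rw [← map_add, hadd]
    have h2 : p.2 ≤ d - α.degree := hle.2
    omega
  choose! p hpt γ hγ hγd using hex
  set s := {α | ∃ f ∈ J, DegLE f d ∧ IsLead o f α}
  have hbl : ∀ α ∈ s, IsLead o (monomial (γ α) 1 * g (p α)) α := fun α hα => by
    have := (hgl _ (hpt α hα)).monomial_mul (γ α)
    rwa [hγ α hα] at this
  have hco : ∀ α ∈ s, coeff α (monomial (γ α) 1 * g (p α)) = coeff (p α).1 (g (p α)) := by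
    intro α hα
    have := coeff_monomial_mul (p α).1 (γ α) 1 (g (p α))
    rwa [hγ α hα, one_mul] at this
  have hσb : ∀ α ∈ s, σ (coeff α (monomial (γ α) 1 * g (p α))) ≠ 0 := fun α hα => by
    rw [hco α hα]
    exact hσp _ (hpt α hα)
  have hspan : h ∈ Submodule.span K
      ((fun α => MvPolynomial.map σ (monomial (γ α) 1 * g (p α))) '' s) := by
    refine (Submodule.span_le.2 ?_ : Submodule.span K
      (MvPolynomial.map σ '' {f | f ∈ J ∧ DegLE f d}) ≤ _) hd
    rintro _ ⟨f, ⟨hf, hfd⟩, rfl⟩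
    exact map_mem_span_of_degLE o σ (s := s) (fun f hf hfd α hα => ⟨f, hf, hfd, hα⟩)
      (fun α hα => J.mul_mem_left _ (hgJ _ (hpt α hα)))
      (fun α hα β hβ => (((hgd _ (hpt α hα)).monomial_mul (γ α)) β hβ).trans (hγd α hα))
      hbl hσb hf hfd
  obtain ⟨α, hα, hlead⟩ := exists_isLead_of_mem_span o
    (fun α hα => (hbl α hα).map σ (hσb α hα)) hspan h0
  refine ⟨g (p α), Finset.mem_coe.2 (Finset.mem_image_of_mem g (hpt α hα)), γ α, (p α).1,
    (hgl _ (hpt α hα)).map σ (hσp _ (hpt α hα)), ?_⟩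
  rwa [hγ α hα]

/-! ### Noetherian induction -/

/-- Relative to a prime `P`, a finite subset of `J` covers for all specializations that kill `P`
but not a suitable constant outside `P`. -/
theorem exists_covers_prime {A : Type u} [CommRing A] (o : MonOrder n)
    (J : Ideal (MvPolynomial (Fin n) A)) (P : Ideal A) [P.IsPrime] :
    ∃ c ∉ P, ∃ G : Finset (MvPolynomial (Fin n) A), (G : Set (MvPolynomial (Fin n) A)) ⊆ J ∧
      ∀ (K : Type v) [Field K] (σ : A →+* K), P ≤ RingHom.ker σ → σ c ≠ 0 →
        Covers o J (G : Set _) σ := by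
  classical
  -- A specialization killing P factors through the domain A/P, where the generic case applies; c
  -- and G are then lifted to A.
  obtain ⟨c, hc, G, hG, hcov⟩ := exists_covers_generic.{u, v} o
    (J.map (MvPolynomial.map (Ideal.Quotient.mk P)))
  obtain ⟨c, rfl⟩ := Ideal.Quotient.mk_surjective c
  have hsurj := MvPolynomial.map_surjective (σ := Fin n) _ (Ideal.Quotient.mk_surjective (I := P))
  choose! l hlJ hl using fun f (hf : f ∈ G) =>
    (Ideal.mem_map_iff_of_surjective _ hsurj).1 (hG hf)
  refine ⟨c, fun h => hc (Ideal.Quotient.eq_zero_iff_mem.2 h), G.image l, ?_,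
    fun K _ σ hP hσ h hh h0 => ?_⟩
  · intro f hf
    obtain ⟨f', hf', rfl⟩ := Finset.mem_image.1 (Finset.mem_coe.1 hf)
    exact hlJ f' hf'
  have hcomp : (Ideal.Quotient.lift P σ hP).comp (Ideal.Quotient.mk P) = σ :=
    Ideal.Quotient.lift_comp_mk ..
  have hmap : ∀ f : MvPolynomial (Fin n) A, MvPolynomial.map (Ideal.Quotient.lift P σ hP)
      (MvPolynomial.map (Ideal.Quotient.mk P) f) = MvPolynomial.map σ f := fun f => by
    rw [MvPolynomial.map_map, hcomp]
  obtain ⟨f, hf, γ, α, hα, hlead⟩ := hcov K (Ideal.Quotient.lift P σ hP) (by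
    rwa [← RingHom.comp_apply, hcomp]) h (by
    rw [Ideal.map_map]
    convert hh using 2
    exact RingHom.ext hmap) h0
  refine ⟨l f, Finset.mem_coe.2 (Finset.mem_image_of_mem l hf), γ, α, ?_, hlead⟩
  rwa [← hmap, hl f hf]

/-- Over a noetherian ring a finite subset of `J` covers for all specializations that kill `P`. -/
theorem exists_covers {A : Type u} [CommRing A] [IsNoetherianRing A] (o : MonOrder n)
    (J : Ideal (MvPolynomial (Fin n) A)) (P : Ideal A) :
    ∃ G : Finset (MvPolynomial (Fin n) A), (G : Set (MvPolynomial (Fin n) A)) ⊆ J ∧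
      ∀ (K : Type v) [Field K] (σ : A →+* K), P ≤ RingHom.ker σ → Covers o J (G : Set _) σ := by
  classical
  induction P using WellFoundedGT.induction with
  | ind P ih =>
    have hlt : ∀ a ∉ P, P < P ⊔ Ideal.span {a} := fun a ha =>
      left_lt_sup.2 fun h => ha (h (Ideal.mem_span_singleton_self a))
    have hker : ∀ {K : Type v} [Field K] (σ : A →+* K) {a : A}, P ≤ RingHom.ker σ → σ a = 0 →
        P ⊔ Ideal.span {a} ≤ RingHom.ker σ := fun σ a hP ha =>
      sup_le hP ((Ideal.span_singleton_le_iff_mem _).2 ha)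
    by_cases htop : P = ⊤
    -- No homomorphism to a field kills the unit ideal, so the empty set suffices.
    · refine ⟨∅, by simp, fun K _ σ hP => ?_⟩
      subst htop
      exact absurd (top_le_iff.1 hP) (RingHom.ker_ne_top σ)
    by_cases hprime : P.IsPrime
    · obtain ⟨c, hc, G, hG, hcov⟩ := exists_covers_prime.{u, v} o J P
      obtain ⟨G', hG', hcov'⟩ := ih _ (hlt c hc)
      refine ⟨G ∪ G', by simpa using ⟨hG, hG'⟩, fun K _ σ hP => ?_⟩
      -- Specializations that kill c also kill the strictly larger ideal P + (c), which the
      -- induction covers.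
      by_cases hσ : σ c = 0
      · exact (hcov' K σ (hker σ hP hσ)).mono (by simp)
      · exact (hcov K σ hP hσ).mono (by simp)
    · rw [Ideal.not_isPrime_iff] at hprime
      obtain ⟨a, ha, b, hb, hab⟩ := hprime.resolve_left htop
      obtain ⟨G, hG, hcov⟩ := ih _ (hlt a ha)
      obtain ⟨G', hG', hcov'⟩ := ih _ (hlt b hb)
      refine ⟨G ∪ G', by simpa using ⟨hG, hG'⟩, fun K _ σ hP => ?_⟩
      -- As K has no zero divisors, σ kills a or b, hence one of the larger ideals P + (a), P + (b).
      have h0 : σ a * σ b = 0 := by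
        rw [← map_mul]
        exact hP hab
      rcases mul_eq_zero.1 h0 with h | h
      · exact (hcov K σ (hker σ hP h)).mono (by simp)
      · exact (hcov' K σ (hker σ hP h)).mono (by simp)

end ParamSB

theorem mainTheorem3 {C : Type u} [CommRing C] [IsDomain C] [IsNoetherianRing C]
    (n : ℕ) (hn : 0 < n) (o : ParamSB.MonOrder n)
    (J : Ideal (MvPolynomial (Fin n) C)) (hJ : J.FG) :
    ∃ G : Finset (MvPolynomial (Fin n) C),
      (G : Set (MvPolynomial (Fin n) C)) ⊆ (J : Set (MvPolynomial (Fin n) C)) ∧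
      ∀ (K : Type v) [Field K] (σ : C →+* K),
        (MvPolynomial.map σ : MvPolynomial (Fin n) C →+* MvPolynomial (Fin n) K) ''
            (J : Set (MvPolynomial (Fin n) C)) ≠ {0} →
          ParamSB.IsStandardBasis o
            (J.map (MvPolynomial.map σ : MvPolynomial (Fin n) C →+* MvPolynomial (Fin n) K))
            ((MvPolynomial.map σ : MvPolynomial (Fin n) C →+* MvPolynomial (Fin n) K) ''
              (G : Set (MvPolynomial (Fin n) C))) := by
  obtain ⟨G, hG, hcov⟩ := ParamSB.exists_covers.{u, v} o J ⊥
  exact ⟨G, hG, fun K _ σ _ => (hcov K σ bot_le).isStandardBasis hG⟩
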